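/- Let $\theta\in(0,1]$, and let $\lambda,a:[0,\infty)\to[0,\infty)$ be measurable with $\Lambda_t=\int_0^t\lambda_u\,du<\infty$ and $a_t\le 1+1/\theta$ for all $t\ge0$. A theta-positive branching process with branching parameter $\theta$ in the varying environment $(\{\lambda_t\},\{a_t\})$ is a time-inhomogeneous Markov branching process $(Z_t)_{t\ge0}$ in continuous time with $Z_0=1$, in which individuals live and reproduce independently, an individual alive at time $t$ dies at rate $\lambda_t$, and an individual dying at time $t$ is instantaneously replaced by a random number of offspring with probability generating function $$h_t(s)=1-a_t(1-s)+\frac{a_t}{1+\theta}(1-s)^{1+\theta},\qquad 0\le s\le1 .$$ If $$\lim_{t\to\infty}\Lambda_t=\infty\qquad\text{and}\qquad\int_0^\infty a_u\lambda_u\,du<\infty ,$$ then the process is strictly subcritical, that is, $$\lim_{t\to\infty}P(Z_t=0)=1\qquad\text{and}\qquad \lim_{t\to\infty}E(Z_t\mid Z_t>0)\ \text{exists in } [1,\infty).$$ -/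

import Mathlib

open MeasureTheory ProbabilityTheory Filter Topology
open scoped NNReal ENNReal

noncomputable section

/-- The cumulative hazard `Λ_t = ∫_0^t λ_u du`. -/
def cumulativeHazard (lam : ℝ → ℝ) (t : ℝ) : ℝ := ∫ u in (0 : ℝ)..t, lam u

/-- The probability generating function `∑_k q(k) s^k` of a law `q` on `ℕ`
(the series converges for `0 ≤ s ≤ 1`). -/
def probGenFun (q : PMF ℕ) (s : ℝ) : ℝ := ∑' k : ℕ, (q k).toReal * s ^ k

/-- The generator at one instant of a Markov branching population: each of the `n` individuals
alive dies at rate `r`, independently of the others, and is replaced at once by `k` offspring with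
probability `q k`, so that the population jumps from `n` to `n + k - 1`:
`(L f)(n) = n r ∑_k q(k) (f (n + k - 1) - f n)`.
(The truncated subtraction is harmless, because of the factor `n`.) -/
def branchingGenerator (r : ℝ) (q : PMF ℕ) (f : ℕ → ℝ) (n : ℕ) : ℝ :=
  (n : ℝ) * r * ∑' k : ℕ, (q k).toReal * (f (n + k - 1) - f n)

/-- `Z` is a (time inhomogeneous) Markov branching process in continuous time, started from one
individual, with death rates `lam t` and offspring laws `p t`, `t ≥ 0`: it has right-continuous
paths with left limits in `ℕ` and solves the martingale problem for the time-dependent branching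
generator, i.e. for every finitely supported `f : ℕ → ℝ`,
`f(Z_t) - f(Z_0) - ∫_0^t (L_u f)(Z_u) du` is a martingale for the natural filtration of `Z`. -/
structure IsMarkovBranchingProcess {Ω : Type*} [MeasurableSpace Ω] (P : Measure Ω)
    (lam : ℝ → ℝ) (p : ℝ → PMF ℕ) (Z : ℝ≥0 → Ω → ℕ) : Prop where
  rate_measurable : Measurable lam
  rate_nonneg : ∀ t : ℝ, 0 ≤ t → 0 ≤ lam t
  rate_integrable : ∀ t : ℝ, 0 ≤ t → IntervalIntegrable lam volume 0 t
  offspring_measurable : ∀ k : ℕ, Measurable fun t : ℝ => p t k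
  offspring_one : ∀ t : ℝ, 0 ≤ t → p t 1 = 0
  measurable : ∀ t, Measurable (Z t)
  initial : ∀ᵐ ω ∂P, Z 0 ω = 1
  right_continuous : ∀ ω, ∀ t, ContinuousWithinAt (fun u => Z u ω) (Set.Ici t) t
  left_limits : ∀ ω, ∀ t, ∃ n : ℕ, Tendsto (fun u => Z u ω) (𝓝[<] t) (𝓝 n)
  martingale : ∀ f : ℕ → ℝ, f.support.Finite →
    Martingale
      (fun (t : ℝ≥0) ω => f (Z t ω) - f (Z 0 ω) -
        ∫ u in (0 : ℝ)..t, branchingGenerator (lam u) (p u) f (Z u.toNNReal ω))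
      (Filtration.natural Z fun t => (measurable t).stronglyMeasurable) P

/-- `h(s) = 1 - a (1 - s) + a (1 + θ)⁻¹ (1 - s)^(1 + θ)`. -/
def thetaPGF (θ a s : ℝ) : ℝ :=
  1 - a * (1 - s) + a * (1 + θ)⁻¹ * (1 - s) ^ (1 + θ)

/-- `Z` is a theta-positive branching process with branching parameter `θ ∈ (0, 1]` in the varying
environment `(lam, a)`: a Markov branching process with death rates `lam t` whose offspring law at
time `t ≥ 0` has generating function `thetaPGF θ (a t)`, where `0 ≤ a t ≤ 1 + 1 / θ`. -/
structure IsThetaPositiveBranchingProcess {Ω : Type*} [MeasurableSpace Ω] (P : Measure Ω)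
    (θ : ℝ) (lam a : ℝ → ℝ) (Z : ℝ≥0 → Ω → ℕ) : Prop where
  theta_pos : 0 < θ
  theta_le_one : θ ≤ 1
  mean_measurable : Measurable a
  mean_nonneg : ∀ t : ℝ, 0 ≤ t → 0 ≤ a t
  mean_le : ∀ t : ℝ, 0 ≤ t → a t ≤ 1 + 1 / θ
  branching : ∃ p : ℝ → PMF ℕ, IsMarkovBranchingProcess P lam p Z ∧
    ∀ t : ℝ, 0 ≤ t → ∀ s ∈ Set.Icc (0 : ℝ) 1, probGenFun (p t) s = thetaPGF θ (a t) s

/-- The conditional mean `m_t = E(Z_t | Z_t > 0)`, as an extended nonnegative number. -/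
def survivalMean {Ω : Type*} [MeasurableSpace Ω] (P : Measure Ω) (Z : ℝ≥0 → Ω → ℕ)
    (t : ℝ≥0) : ℝ≥0∞ :=
  ∫⁻ ω, (Z t ω : ℝ≥0∞) ∂(P[|{ω | 0 < Z t ω}])

/-- Strict subcriticality: `q = lim P(Z_t = 0)` equals `1`, and `lim m_t` exists in `[1, ∞)`. -/
def IsStrictlySubcritical {Ω : Type*} [MeasurableSpace Ω] (P : Measure Ω)
    (Z : ℝ≥0 → Ω → ℕ) : Prop :=
  Tendsto (fun t => P {ω | Z t ω = 0}) atTop (𝓝 1) ∧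
    ∃ m : ℝ≥0, 1 ≤ m ∧ Tendsto (survivalMean P Z) atTop (𝓝 (m : ℝ≥0∞))

end

/-! The generating function `E s ^ Z_T` is the value at time `0` of the solution of the backward
equation `φ' = -(h_u(φ) - φ) λ_u` with `φ_T = s`. For the theta-positive family this is a Bernoulli
equation: `H = (1 - φ) ^ (-θ)` satisfies a linear equation, solved explicitly through `D = netDeath`
and `J = weightedBirth`. Hence `P(Z_t > 0) = (exp (θ D_t) + θ / (1 + θ) J_t) ^ (-1 / θ)`, and
letting `s → 1` gives `E Z_t ≤ exp (-D_t)`.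

Summability of `a λ` makes `D_t` differ from `Λ_t` by a bounded amount, so `D_t → ∞` and extinction
is certain. Dividing the two formulas, `1 ≤ E(Z_t | Z_t > 0) ≤ (1 + θ / (1 + θ) J_t exp (-θ D_t)) ^
(1 / θ)`. The product `J_t exp (-θ D_t)` tends to `0` by dominated convergence
(`tendsto_weightedBirth_mul_exp`), so the conditional mean tends to `1`.

The analytic core is the duality `integral_pow_eq_of_backward`. The martingale problem only admits
finitely supported test functions, so `x ^ n` is truncated at `n ≤ M`; the error is geometrically
small in `M` because `φ` stays below some `ρ < 1` (`abs_truncated_generator_le`). -/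

/-! ### Calculus of absolutely continuous functions, as the rates are merely locally integrable. -/

/-- `f` is absolutely continuous on `[0, T]` and has derivative `f'` almost everywhere there. -/
def HasACDeriv (T : ℝ) (f f' : ℝ → ℝ) : Prop :=
  AbsolutelyContinuousOnInterval f 0 T ∧ ∀ᵐ x : ℝ, x ∈ Set.uIcc 0 T → HasDerivAt f (f' x) x

namespace HasACDeriv

variable {T : ℝ} {f f' g g' : ℝ → ℝ}

theorem integral (h : IntervalIntegrable f volume 0 T) :
    HasACDeriv T (fun x => ∫ u in (0 : ℝ)..x, f u) f :=
  ⟨h.absolutelyContinuousOnInterval_intervalIntegral Set.left_mem_uIcc, by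
    filter_upwards [h.ae_hasDerivAt_integral] with x hx hxT
    exact hx hxT 0 Set.left_mem_uIcc⟩

theorem const (c : ℝ) : HasACDeriv T (fun _ => c) (fun _ => 0) :=
  ⟨(LipschitzWith.const c).lipschitzOnWith.absolutelyContinuousOnInterval,
    ae_of_all _ fun x _ => hasDerivAt_const x c⟩

theorem add (hf : HasACDeriv T f f') (hg : HasACDeriv T g g') :
    HasACDeriv T (fun x => f x + g x) (fun x => f' x + g' x) :=
  ⟨hf.1.add hg.1, by
    filter_upwards [hf.2, hg.2] with x h1 h2 hx using (h1 hx).add (h2 hx)⟩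

theorem mul (hf : HasACDeriv T f f') (hg : HasACDeriv T g g') :
    HasACDeriv T (fun x => f x * g x) (fun x => f' x * g x + f x * g' x) :=
  ⟨hf.1.mul hg.1, by
    filter_upwards [hf.2, hg.2] with x h1 h2 hx using (h1 hx).mul (h2 hx)⟩

theorem sum {ι : Type*} (s : Finset ι) {F F' : ι → ℝ → ℝ}
    (h : ∀ i ∈ s, HasACDeriv T (F i) (F' i)) :
    HasACDeriv T (fun x => ∑ i ∈ s, F i x) (fun x => ∑ i ∈ s, F' i x) := by
  classical
  induction s using Finset.induction_on with
  | empty => simpa using const 0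
  | insert i s hi ih =>
    simp only [Finset.sum_insert hi]
    exact (h i (Finset.mem_insert_self i s)).add
      (ih fun j hj => h j (Finset.mem_insert_of_mem hj))

theorem congr_deriv (hf : HasACDeriv T f f')
    (h : ∀ x ∈ Set.uIcc 0 T, f' x = g' x) : HasACDeriv T f g' :=
  ⟨hf.1, by filter_upwards [hf.2] with x h1 hx using h x hx ▸ h1 hx⟩

/-- The image of the interval under `f` is compact and convex, so a function that is `C¹` at its
points is Lipschitz on it. -/
theorem comp {G G' : ℝ → ℝ} (hf : HasACDeriv T f f')
    (hG : ∀ x ∈ Set.uIcc 0 T, ContDiffAt ℝ 1 G (f x))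
    (hG' : ∀ x ∈ Set.uIcc 0 T, HasDerivAt G (G' (f x)) (f x)) :
    HasACDeriv T (fun x => G (f x)) (fun x => G' (f x) * f' x) := by
  refine ⟨?_, ?_⟩
  · have hcompact : IsCompact (f '' Set.uIcc 0 T) :=
      isCompact_uIcc.image_of_continuousOn hf.1.continuousOn
    have hconvex : Convex ℝ (f '' Set.uIcc 0 T) :=
      ((Set.ordConnected_uIcc.isPreconnected.image f hf.1.continuousOn).ordConnected).convex
    have hdiff : ContDiffOn ℝ 1 G (f '' Set.uIcc 0 T) := by
      rintro _ ⟨x, hx, rfl⟩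
      exact (hG x hx).contDiffWithinAt
    obtain ⟨K, hK⟩ := hdiff.exists_lipschitzOnWith (by decide) hconvex hcompact
    have h := hf.1
    rw [absolutelyContinuousOnInterval_iff] at h ⊢
    intro ε hε
    -- `K + 1` rather than `K`, since the Lipschitz constant may vanish.
    obtain ⟨δ, hδ, H⟩ := h (ε / (K + 1)) (by positivity)
    refine ⟨δ, hδ, fun E hE hEδ => ?_⟩
    have h1 := H E hE hEδ
    have h2 : ∀ i ∈ Finset.range E.1, dist (G (f (E.2 i).1)) (G (f (E.2 i).2)) ≤
        K * dist (f (E.2 i).1) (f (E.2 i).2) := fun i hi =>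
      hK.dist_le_mul _ ⟨_, (hE.1 i hi).1, rfl⟩ _ ⟨_, (hE.1 i hi).2, rfl⟩
    calc _ ≤ ∑ i ∈ Finset.range E.1, K * dist (f (E.2 i).1) (f (E.2 i).2) := Finset.sum_le_sum h2
      _ = K * ∑ i ∈ Finset.range E.1, dist (f (E.2 i).1) (f (E.2 i).2) := by rw [Finset.mul_sum]
      _ ≤ (K + 1) * ∑ i ∈ Finset.range E.1, dist (f (E.2 i).1) (f (E.2 i).2) := by
        gcongr
        simp
      _ < (K + 1) * (ε / (K + 1)) := by gcongr
      _ = ε := by field_simp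
  · filter_upwards [hf.2] with x h1 hx using (hG' x hx).comp x (h1 hx)

theorem exp (hf : HasACDeriv T f f') :
    HasACDeriv T (fun x => Real.exp (f x)) (fun x => Real.exp (f x) * f' x) :=
  hf.comp (fun _ _ => Real.contDiff_exp.contDiffAt) fun x _ => Real.hasDerivAt_exp (f x)

theorem pow (hf : HasACDeriv T f f') (n : ℕ) :
    HasACDeriv T (fun x => f x ^ n) (fun x => n * f x ^ (n - 1) * f' x) :=
  hf.comp (G := fun y => y ^ n) (G' := fun y => n * y ^ (n - 1))
    (fun _ _ => (contDiff_id.pow n).contDiffAt) fun x _ => hasDerivAt_pow n (f x)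

theorem rpow (hf : HasACDeriv T f f') (p : ℝ) (hpos : ∀ x ∈ Set.uIcc 0 T, 0 < f x) :
    HasACDeriv T (fun x => f x ^ p) (fun x => p * f x ^ (p - 1) * f' x) :=
  hf.comp (G := fun y => y ^ p) (G' := fun y => p * y ^ (p - 1))
    (fun x hx => Real.contDiffAt_rpow_const_of_ne (hpos x hx).ne')
    fun x hx => Real.hasDerivAt_rpow_const (Or.inl (hpos x hx).ne')

theorem integral_eq_sub (hf : HasACDeriv T f f') :
    IntervalIntegrable f' volume 0 T ∧ ∫ u in (0 : ℝ)..T, f' u = f T - f 0 := by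
  have hae : ∀ᵐ x, x ∈ Set.uIoc 0 T → deriv f x = f' x := by
    filter_upwards [hf.2] with x h1 hx using (h1 (Set.uIoc_subset_uIcc hx)).deriv
  refine ⟨?_, ?_⟩
  · refine hf.1.intervalIntegrable_deriv.congr_ae ?_
    rwa [Filter.EventuallyEq, ae_restrict_iff' measurableSet_uIoc]
  · rw [← hf.1.integral_deriv_eq_sub]
    exact (intervalIntegral.integral_congr_ae hae).symm

theorem abs_sub_le (hT : 0 ≤ T) (hf : HasACDeriv T f f') {b : ℝ → ℝ}
    (hb : IntervalIntegrable b volume 0 T)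
    (h : ∀ᵐ x : ℝ, x ∈ Set.Icc 0 T → HasDerivAt f (f' x) x → |f' x| ≤ b x) :
    |f T - f 0| ≤ ∫ u in (0 : ℝ)..T, b u := by
  rw [← hf.integral_eq_sub.2, ← Real.norm_eq_abs]
  refine intervalIntegral.norm_integral_le_of_norm_le hT ?_ hb
  filter_upwards [h, hf.2] with x h1 h2 hx
  have hx' : x ∈ Set.Icc 0 T := ⟨hx.1.le, hx.2⟩
  exact h1 hx' (h2 (by rwa [Set.uIcc_of_le hT]))

theorem mono (hf : HasACDeriv T f f') {t : ℝ} (ht : 0 ≤ t) (htT : t ≤ T) :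
    HasACDeriv t f f' := by
  have hsub : Set.uIcc 0 t ⊆ Set.uIcc 0 T := by
    rw [Set.uIcc_of_le ht, Set.uIcc_of_le (ht.trans htT)]
    exact Set.Icc_subset_Icc_right htT
  exact ⟨hf.1.mono hsub, by filter_upwards [hf.2] with x h1 hx using h1 (hsub hx)⟩

theorem le_of_deriv_nonneg (hf : HasACDeriv T f f') {t : ℝ} (ht : 0 ≤ t) (htT : t ≤ T)
    (h : ∀ x, 0 ≤ x → x ≤ T → 0 ≤ f' x) : f t ≤ f T := by
  have h1 := (hf.mono ht htT).integral_eq_sub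
  have h2 := hf.integral_eq_sub
  have h3 : ∫ u in t..T, f' u = f T - f t := by
    rw [← intervalIntegral.integral_interval_sub_left h2.1 h1.1, h1.2, h2.2]
    ring
  have h4 : 0 ≤ ∫ u in t..T, f' u :=
    intervalIntegral.integral_nonneg htT fun u hu => h u (ht.trans hu.1) hu.2
  linarith

end HasACDeriv

/-! ### Explicit solution of the backward equation -/

/-- `D_t = ∫_0^t (1 - a_u) λ_u du`, so that `exp (-D_t)` is the mean population size. -/
noncomputable def netDeath (lam a : ℝ → ℝ) (t : ℝ) : ℝ := ∫ u in (0 : ℝ)..t, (1 - a u) * lam u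

/-- `∫_0^t a_u λ_u exp (θ D_u) du`. -/
noncomputable def weightedBirth (θ : ℝ) (lam a : ℝ → ℝ) (t : ℝ) : ℝ :=
  ∫ u in (0 : ℝ)..t, a u * lam u * Real.exp (θ * netDeath lam a u)

/-- The solution `H` of `H' = -θ ((1 - a) H + a / (1 + θ)) λ` with terminal value `H_T = κ`. -/
noncomputable def bernoulliSolution (θ : ℝ) (lam a : ℝ → ℝ) (κ T u : ℝ) : ℝ :=
  Real.exp (-θ * netDeath lam a u) *
    (κ * Real.exp (θ * netDeath lam a T) +
      θ / (1 + θ) * (weightedBirth θ lam a T - weightedBirth θ lam a u))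

/-- The solution `φ` of the backward equation `φ' = -(h_u(φ) - φ) λ_u` with `φ_T = s`. -/
noncomputable def backwardPGF (θ : ℝ) (lam a : ℝ → ℝ) (s T u : ℝ) : ℝ :=
  1 - bernoulliSolution θ lam a ((1 - s) ^ (-θ)) T u ^ (-(1 / θ))

section Backward

variable {θ : ℝ} {lam a : ℝ → ℝ} {T : ℝ}

theorem intervalIntegrable_netDeath (hlam : IntervalIntegrable lam volume 0 T)
    (halam : IntervalIntegrable (fun u => a u * lam u) volume 0 T) :
    IntervalIntegrable (fun u => (1 - a u) * lam u) volume 0 T :=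
  (hlam.sub halam).congr fun u _ => by ring

theorem hasACDeriv_netDeath (hlam : IntervalIntegrable lam volume 0 T)
    (halam : IntervalIntegrable (fun u => a u * lam u) volume 0 T) :
    HasACDeriv T (netDeath lam a) (fun u => (1 - a u) * lam u) :=
  HasACDeriv.integral (intervalIntegrable_netDeath hlam halam)

theorem hasACDeriv_exp_netDeath (c : ℝ) (hlam : IntervalIntegrable lam volume 0 T)
    (halam : IntervalIntegrable (fun u => a u * lam u) volume 0 T) :
    HasACDeriv T (fun u => Real.exp (c * netDeath lam a u))
      (fun u => Real.exp (c * netDeath lam a u) * (c * ((1 - a u) * lam u))) :=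
  (((HasACDeriv.const c).mul (hasACDeriv_netDeath hlam halam)).exp).congr_deriv
    fun x _ => by ring

theorem hasACDeriv_weightedBirth (hlam : IntervalIntegrable lam volume 0 T)
    (halam : IntervalIntegrable (fun u => a u * lam u) volume 0 T) :
    HasACDeriv T (weightedBirth θ lam a)
      (fun u => a u * lam u * Real.exp (θ * netDeath lam a u)) :=
  HasACDeriv.integral
    (halam.mul_continuousOn (hasACDeriv_exp_netDeath θ hlam halam).1.continuousOn)

theorem hasACDeriv_bernoulliSolution (hθ : 0 < θ) (κ : ℝ)
    (hlam : IntervalIntegrable lam volume 0 T)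
    (halam : IntervalIntegrable (fun u => a u * lam u) volume 0 T) :
    HasACDeriv T (bernoulliSolution θ lam a κ T)
      (fun u => -θ * ((1 - a u) * bernoulliSolution θ lam a κ T u + a u / (1 + θ)) * lam u) := by
  have h := (hasACDeriv_exp_netDeath (-θ) hlam halam).mul
    ((HasACDeriv.const (κ * Real.exp (θ * netDeath lam a T) +
      θ / (1 + θ) * weightedBirth θ lam a T)).add
      ((HasACDeriv.const (-(θ / (1 + θ)))).mul (hasACDeriv_weightedBirth (θ := θ) hlam halam)))
  have hfun : bernoulliSolution θ lam a κ T = fun u => Real.exp (-θ * netDeath lam a u) *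
      ((κ * Real.exp (θ * netDeath lam a T) + θ / (1 + θ) * weightedBirth θ lam a T) +
        -(θ / (1 + θ)) * weightedBirth θ lam a u) := by
    funext u
    simp only [bernoulliSolution]
    ring
  rw [hfun]
  refine h.congr_deriv fun u _ => ?_
  have hexp : Real.exp (-θ * netDeath lam a u) * Real.exp (θ * netDeath lam a u) = 1 := by
    rw [← Real.exp_add]
    simp
  have h1 : (1 + θ) ≠ 0 := by positivity
  linear_combination (-(θ / (1 + θ)) * (a u * lam u)) * hexp

/-- The function `exp (θ D) + θ / (1 + θ) J` has derivative `θ ^ 2 / (1 + θ) (1 + 1 / θ - a) λ exp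
(θ D)`, so the bound `a ≤ 1 + 1 / θ` makes it nondecreasing; comparing its values at `u` and `T`
gives the claim. It is what keeps `φ` nonnegative. -/
theorem one_le_bernoulliSolution (hθ : 0 < θ) {κ : ℝ} (hκ : 1 ≤ κ)
    (hlam : IntervalIntegrable lam volume 0 T)
    (halam : IntervalIntegrable (fun u => a u * lam u) volume 0 T)
    (hlam0 : ∀ t, 0 ≤ t → 0 ≤ lam t) (ha : ∀ t, 0 ≤ t → a t ≤ 1 + 1 / θ)
    {u : ℝ} (hu : 0 ≤ u) (huT : u ≤ T) : 1 ≤ bernoulliSolution θ lam a κ T u := by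
  have hK := (hasACDeriv_exp_netDeath θ hlam halam).add
    ((HasACDeriv.const (θ / (1 + θ))).mul (hasACDeriv_weightedBirth (θ := θ) hlam halam))
  have hle := hK.le_of_deriv_nonneg hu huT fun x hx0 _ => by
    have h1 : 0 ≤ θ * (1 - a x) + θ / (1 + θ) * a x := by
      have h2 : θ * (1 - a x) + θ / (1 + θ) * a x =
          θ ^ 2 / (1 + θ) * (1 + 1 / θ - a x) := by
        field_simp
        ring
      rw [h2]
      exact mul_nonneg (by positivity) (sub_nonneg.2 (ha x hx0))
    have h3 := mul_nonneg h1
      (mul_nonneg (hlam0 x hx0) (Real.exp_pos (θ * netDeath lam a x)).le)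
    linarith
  have hexp : Real.exp (-θ * netDeath lam a u) * Real.exp (θ * netDeath lam a u) = 1 := by
    rw [← Real.exp_add]
    simp
  refine hexp.symm.le.trans (mul_le_mul_of_nonneg_left ?_ (Real.exp_pos _).le)
  have := mul_le_mul_of_nonneg_right hκ (Real.exp_pos (θ * netDeath lam a T)).le
  linarith

theorem one_le_terminal (hθ : 0 < θ) {s : ℝ} (hs0 : 0 ≤ s) (hs1 : s < 1) :
    1 ≤ (1 - s) ^ (-θ) :=
  Real.one_le_rpow_of_pos_of_le_one_of_nonpos (by linarith) (by linarith) (by linarith)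

/-- Bernoulli substitution undone: `1 - φ = H ^ (-1 / θ)`, hence `(1 - φ) ^ (1 + θ) = H ^ (-1 / θ -
1)`. -/
theorem hasACDeriv_backwardPGF (hθ : 0 < θ) {s : ℝ} (hs0 : 0 ≤ s) (hs1 : s < 1) (hT : 0 ≤ T)
    (hlam : IntervalIntegrable lam volume 0 T)
    (halam : IntervalIntegrable (fun u => a u * lam u) volume 0 T)
    (hlam0 : ∀ t, 0 ≤ t → 0 ≤ lam t) (ha : ∀ t, 0 ≤ t → a t ≤ 1 + 1 / θ) :
    HasACDeriv T (backwardPGF θ lam a s T)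
      (fun u => -(thetaPGF θ (a u) (backwardPGF θ lam a s T u) -
        backwardPGF θ lam a s T u) * lam u) := by
  have hpos : ∀ x ∈ Set.uIcc 0 T, 0 < bernoulliSolution θ lam a ((1 - s) ^ (-θ)) T x := by
    intro x hx
    rw [Set.uIcc_of_le hT] at hx
    linarith [one_le_bernoulliSolution hθ (one_le_terminal hθ hs0 hs1) hlam halam hlam0 ha
      hx.1 hx.2]
  have h := (HasACDeriv.const 1).add ((HasACDeriv.const (-1)).mul
    ((hasACDeriv_bernoulliSolution hθ ((1 - s) ^ (-θ)) hlam halam).rpow (-(1 / θ)) hpos))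
  have hfun : backwardPGF θ lam a s T = fun u =>
      1 + (-1) * bernoulliSolution θ lam a ((1 - s) ^ (-θ)) T u ^ (-(1 / θ)) := by
    funext u
    simp only [backwardPGF]
    ring
  rw [hfun]
  refine h.congr_deriv fun u hu => ?_
  simp only [thetaPGF]
  have hH := hpos u hu
  set H := bernoulliSolution θ lam a ((1 - s) ^ (-θ)) T u
  have e1 : H ^ (-(1 / θ) - 1) * H = H ^ (-(1 / θ)) := by
    rw [← Real.rpow_add_one hH.ne']
    congr 1
    ring
  have e2 : (1 - (1 + -1 * H ^ (-(1 / θ)))) ^ (1 + θ) = H ^ (-(1 / θ) - 1) := by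
    rw [show 1 - (1 + -1 * H ^ (-(1 / θ))) = H ^ (-(1 / θ)) by ring, ← Real.rpow_mul hH.le]
    congr 1
    field_simp
    ring
  rw [e2, ← e1]
  field_simp
  ring

/-- The uniform gap `ρ < 1` comes from boundedness of `H` on `[0, T]`; the duality argument needs it
to control the truncation. -/
theorem backwardPGF_mem (hθ : 0 < θ) {s : ℝ} (hs0 : 0 ≤ s) (hs1 : s < 1) (hT : 0 ≤ T)
    (hlam : IntervalIntegrable lam volume 0 T)
    (halam : IntervalIntegrable (fun u => a u * lam u) volume 0 T)
    (hlam0 : ∀ t, 0 ≤ t → 0 ≤ lam t) (ha : ∀ t, 0 ≤ t → a t ≤ 1 + 1 / θ) :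
    ∃ ρ, 0 < ρ ∧ ρ < 1 ∧ ∀ u, 0 ≤ u → u ≤ T →
      0 ≤ backwardPGF θ lam a s T u ∧ backwardPGF θ lam a s T u ≤ ρ := by
  obtain ⟨C, hC⟩ := (hasACDeriv_bernoulliSolution hθ ((1 - s) ^ (-θ)) hlam halam).1.exists_bound
  have hC' : ∀ u, 0 ≤ u → u ≤ T → bernoulliSolution θ lam a ((1 - s) ^ (-θ)) T u ≤ max C 2 := by
    intro u hu huT
    exact ((le_abs_self _).trans (hC u (by rw [Set.uIcc_of_le hT]; exact ⟨hu, huT⟩))).trans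
      (le_max_left _ _)
  -- Raising the bound to at least `2` ensures `ρ > 0`.
  have h2 : (2 : ℝ) ≤ max C 2 := le_max_right _ _
  have hpow : max C 2 ^ (-(1 / θ)) < 1 :=
    Real.rpow_lt_one_of_one_lt_of_neg (by linarith) (by simpa using hθ)
  refine ⟨1 - max C 2 ^ (-(1 / θ)), by linarith,
    by linarith [Real.rpow_pos_of_pos (show 0 < max C 2 by linarith) (-(1 / θ))],
    fun u hu huT => ?_⟩
  have h1 := one_le_bernoulliSolution hθ (one_le_terminal hθ hs0 hs1) hlam halam hlam0 ha hu huT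
  have hneg : -(1 / θ) ≤ 0 := by simpa using hθ.le
  have h3 := Real.rpow_le_one_of_one_le_of_nonpos h1 hneg
  have h4 := Real.rpow_le_rpow_of_nonpos (by linarith) (hC' u hu huT) hneg
  simp only [backwardPGF]
  constructor <;> linarith

theorem backwardPGF_terminal (hθ : 0 < θ) {s : ℝ} (hs1 : s < 1) :
    backwardPGF θ lam a s T T = s := by
  have hexp : Real.exp (-θ * netDeath lam a T) * Real.exp (θ * netDeath lam a T) = 1 := by
    rw [← Real.exp_add]
    simp
  have h : bernoulliSolution θ lam a ((1 - s) ^ (-θ)) T T = (1 - s) ^ (-θ) := by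
    simp only [bernoulliSolution]
    linear_combination (1 - s) ^ (-θ) * hexp
  rw [backwardPGF, h, ← Real.rpow_mul (by linarith)]
  have : -θ * -(1 / θ) = 1 := by field_simp
  rw [this, Real.rpow_one]
  ring

theorem backwardPGF_zero (s : ℝ) :
    backwardPGF θ lam a s T 0 = 1 - ((1 - s) ^ (-θ) * Real.exp (θ * netDeath lam a T) +
      θ / (1 + θ) * weightedBirth θ lam a T) ^ (-(1 / θ)) := by
  simp [backwardPGF, bernoulliSolution, netDeath, weightedBirth]

end Backward

/-! ### The branching generator on geometrically decaying functions -/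

section Generator

theorem hasSum_toReal_pmf (q : PMF ℕ) : HasSum (fun k => (q k).toReal) 1 := by
  have h := ENNReal.summable_toReal (f := fun k => q k) (by simp [q.tsum_coe])
  have h1 : ∑' k, (q k).toReal = 1 := by
    rw [← ENNReal.tsum_toReal_eq fun k => q.apply_ne_top k, q.tsum_coe, ENNReal.toReal_one]
  exact h1 ▸ h.hasSum

theorem summable_pmf_mul (q : PMF ℕ) {g : ℕ → ℝ} {C : ℝ} (hg : ∀ k, |g k| ≤ C) :
    Summable fun k => (q k).toReal * g k := by
  refine Summable.of_norm_bounded ((hasSum_toReal_pmf q).summable.mul_right C) fun k => ?_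
  rw [Real.norm_eq_abs, abs_mul, abs_of_nonneg ENNReal.toReal_nonneg]
  gcongr
  exact hg k

theorem abs_tsum_pmf_mul_le (q : PMF ℕ) {g : ℕ → ℝ} {C : ℝ} (hg : ∀ k, |g k| ≤ C) :
    |∑' k, (q k).toReal * g k| ≤ C := by
  have h := (hasSum_toReal_pmf q).mul_right C
  rw [one_mul] at h
  rw [← Real.norm_eq_abs]
  refine tsum_of_norm_bounded h fun k => ?_
  rw [Real.norm_eq_abs, abs_mul, abs_of_nonneg ENNReal.toReal_nonneg]
  gcongr
  exact hg k

/-- The left side is `n` copies of the smallest of the first `n` terms of the geometric series. -/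
theorem nat_mul_pow_pred_le {r : ℝ} (hr0 : 0 ≤ r) (hr1 : r < 1) (n : ℕ) :
    (n : ℝ) * r ^ (n - 1) ≤ 1 / (1 - r) := by
  have h1 : (n : ℝ) * r ^ (n - 1) ≤ ∑ k ∈ Finset.range n, r ^ k := by
    have h := Finset.card_nsmul_le_sum (Finset.range n) (fun k => r ^ k) (r ^ (n - 1))
      fun k hk => pow_le_pow_of_le_one hr0 hr1.le (by have := Finset.mem_range.1 hk; omega)
    rwa [Finset.card_range, nsmul_eq_mul] at h
  refine h1.trans ?_
  rw [one_div, ← tsum_geometric_of_lt_one hr0 hr1]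
  exact (summable_geometric_of_lt_one hr0 hr1).sum_le_tsum _ fun k _ => pow_nonneg hr0 k

variable {f g : ℕ → ℝ} {C : ℝ}

/-- Geometric decay of `f` absorbs the unbounded total jump rate `n |lam|`, so the bound is uniform
in `n`. -/
theorem abs_branchingGenerator_le {r K : ℝ} (hr0 : 0 ≤ r) (hr1 : r < 1)
    (hf : ∀ j, |f j| ≤ K * r ^ j) (lam : ℝ) (q : PMF ℕ) (n : ℕ) :
    |branchingGenerator lam q f n| ≤ 2 * K / (1 - r) * |lam| := by
  have hK : 0 ≤ K := by simpa using (abs_nonneg _).trans (hf 0)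
  have h1r : 0 < 1 - r := by linarith
  -- The exponent `n - 1` is the worst case `k = 0`, a death without offspring.
  have h1 : ∀ k, |f (n + k - 1) - f n| ≤ 2 * K * r ^ (n - 1) := fun k => by
    have e1 := hf (n + k - 1)
    have e2 := hf n
    have e3 : r ^ (n + k - 1) ≤ r ^ (n - 1) := pow_le_pow_of_le_one hr0 hr1.le (by omega)
    have e4 : r ^ n ≤ r ^ (n - 1) := pow_le_pow_of_le_one hr0 hr1.le (by omega)
    calc |f (n + k - 1) - f n| ≤ |f (n + k - 1)| + |f n| := abs_sub _ _
      _ ≤ K * r ^ (n - 1) + K * r ^ (n - 1) := by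
        gcongr
        · exact e1.trans (by gcongr)
        · exact e2.trans (by gcongr)
      _ = 2 * K * r ^ (n - 1) := by ring
  rw [branchingGenerator, abs_mul, abs_mul, Nat.abs_cast]
  calc (n : ℝ) * |lam| * |∑' k, (q k).toReal * (f (n + k - 1) - f n)|
      ≤ (n : ℝ) * |lam| * (2 * K * r ^ (n - 1)) := by
        gcongr
        exact abs_tsum_pmf_mul_le q h1
    _ = 2 * K * ((n : ℝ) * r ^ (n - 1)) * |lam| := by ring
    _ ≤ 2 * K * (1 / (1 - r)) * |lam| := by
        gcongr
        exact nat_mul_pow_pred_le hr0 hr1 n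
    _ = 2 * K / (1 - r) * |lam| := by ring

theorem summable_branchingGenerator (q : PMF ℕ) (hf : ∀ j, |f j| ≤ C) (n : ℕ) :
    Summable fun k => (q k).toReal * (f (n + k - 1) - f n) :=
  summable_pmf_mul q (C := C + C) fun _ => (abs_sub _ _).trans (add_le_add (hf _) (hf _))

theorem branchingGenerator_sub {C' : ℝ} (lam : ℝ) (q : PMF ℕ) (hf : ∀ j, |f j| ≤ C)
    (hg : ∀ j, |g j| ≤ C') (n : ℕ) :
    branchingGenerator lam q (fun j => f j - g j) n =
      branchingGenerator lam q f n - branchingGenerator lam q g n := by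
  simp only [branchingGenerator]
  rw [← mul_sub, ← (summable_branchingGenerator q hf n).tsum_sub
    (summable_branchingGenerator q hg n)]
  congr 1
  exact tsum_congr fun _ => by ring

theorem branchingGenerator_sum_mul {ι : Type*} (s : Finset ι) (c : ι → ℝ) (F : ι → ℕ → ℝ)
    (hF : ∀ i j, |F i j| ≤ C) (lam : ℝ) (q : PMF ℕ) (n : ℕ) :
    branchingGenerator lam q (fun j => ∑ i ∈ s, c i * F i j) n =
      ∑ i ∈ s, c i * branchingGenerator lam q (F i) n := by
  simp only [branchingGenerator]
  calc _ = n * lam * ∑' k, ∑ i ∈ s, c i * ((q k).toReal * (F i (n + k - 1) - F i n)) := by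
        congr 1
        refine tsum_congr fun k => ?_
        rw [← Finset.sum_sub_distrib, Finset.mul_sum]
        exact Finset.sum_congr rfl fun i _ => by ring
    _ = n * lam * ∑ i ∈ s, c i * ∑' k, (q k).toReal * (F i (n + k - 1) - F i n) := by
        rw [Summable.tsum_finsetSum fun i _ =>
          (summable_branchingGenerator q (hF i) n).mul_left (c i)]
        simp only [tsum_mul_left]
    _ = _ := by
        rw [Finset.mul_sum]
        exact Finset.sum_congr rfl fun i _ => by ring

theorem branchingGenerator_pow {x : ℝ} (hx0 : 0 ≤ x) (hx1 : x ≤ 1) (lam : ℝ) (q : PMF ℕ)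
    (n : ℕ) :
    branchingGenerator lam q (fun j => x ^ j) n =
      n * x ^ (n - 1) * (probGenFun q x - x) * lam := by
  rcases n with _ | n
  · simp [branchingGenerator]
  have hpow : ∀ j, |x ^ j| ≤ 1 := fun j => by
    rw [abs_of_nonneg (pow_nonneg hx0 j)]
    exact pow_le_one₀ hx0 hx1
  have h1 : ∑' k, (q k).toReal * (x ^ (n + 1 + k - 1) - x ^ (n + 1)) =
      x ^ n * (probGenFun q x - x) := by
    have h2 := (((summable_pmf_mul q hpow).hasSum).sub
      ((hasSum_toReal_pmf q).mul_right x)).mul_left (x ^ n)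
    rw [one_mul] at h2
    rw [probGenFun, ← h2.tsum_eq]
    refine tsum_congr fun k => ?_
    rw [show n + 1 + k - 1 = n + k by omega]
    ring
  rw [branchingGenerator, h1, Nat.add_sub_cancel]
  ring

theorem probGenFun_mem {x : ℝ} (hx0 : 0 ≤ x) (hx1 : x ≤ 1) (q : PMF ℕ) :
    0 ≤ probGenFun q x ∧ probGenFun q x ≤ 1 := by
  have hpow : ∀ j, |x ^ j| ≤ 1 := fun j => by
    rw [abs_of_nonneg (pow_nonneg hx0 j)]
    exact pow_le_one₀ hx0 hx1
  exact ⟨tsum_nonneg fun k => mul_nonneg ENNReal.toReal_nonneg (pow_nonneg hx0 k),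
    (abs_le.1 (abs_tsum_pmf_mul_le q hpow)).2⟩

/-- Truncating `x ^ n` to `n ≤ M` changes the space-time generator, which annihilates it when `x`
moves along the backward equation, by an amount that is geometrically small in `M`. -/
theorem abs_truncated_generator_le {x r lam : ℝ} (hr0 : 0 ≤ r) (hr1 : r < 1) (hx0 : 0 ≤ x)
    (hxr : x ≤ r ^ 2) (hlam : 0 ≤ lam) (q : PMF ℕ) (M m : ℕ) :
    |∑ n ∈ Finset.range (M + 1),
      ((n : ℝ) * x ^ (n - 1) * (-(probGenFun q x - x) * lam) * (if m = n then 1 else 0) +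
        x ^ n * branchingGenerator lam q (fun j => if j = n then 1 else 0) m)| ≤
      3 / (1 - r) * r ^ M * lam := by
  have hx1 : x ≤ 1 := hxr.trans (pow_le_one₀ hr0 hr1.le)
  have h1r : 0 < 1 - r := by linarith
  set b := probGenFun q x - x with hb
  have hb1 : |b| ≤ 1 := by
    obtain ⟨h0, h1⟩ := probGenFun_mem hx0 hx1 q
    rw [abs_le]
    constructor <;> linarith
  have hxpow : ∀ j, x ^ j ≤ r ^ j * r ^ j := fun j => by
    rw [← mul_pow, ← sq]
    exact pow_le_pow_left₀ hx0 hxr j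
  have hpow : ∀ j, |x ^ j| ≤ 1 := fun j => by
    rw [abs_of_nonneg (pow_nonneg hx0 j)]
    exact pow_le_one₀ hx0 hx1
  have hite : ∀ n j : ℕ, |if j = n then (1 : ℝ) else 0| ≤ 1 := fun n j => by
    split_ifs <;> simp
  set fM : ℕ → ℝ := fun j => ∑ n ∈ Finset.range (M + 1), x ^ n * if j = n then 1 else 0 with hfM
  have hfM' : ∀ j, fM j = if j < M + 1 then x ^ j else 0 := fun j => by
    simp [hfM]
  have hfM1 : ∀ j, |fM j| ≤ 1 := fun j => by
    rw [hfM']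
    split_ifs
    · exact hpow j
    · simp
  -- Beyond the cutoff `x ^ j ≤ r ^ j * r ^ j`: one factor supplies the smallness `r ^ M`, the other
  -- the decay needed to bound the generator.
  have hdiff : ∀ j, |x ^ j - fM j| ≤ r ^ M * r ^ j := fun j => by
    rw [hfM']
    split_ifs with h
    · simp only [sub_self, abs_zero]
      positivity
    · rw [sub_zero, abs_of_nonneg (pow_nonneg hx0 j)]
      refine (hxpow j).trans ?_
      gcongr ?_ * _
      exact pow_le_pow_of_le_one hr0 hr1.le (by omega)
  -- The generator applied to the full power is `m x ^ (m - 1) b lam`, which cancels the drift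
  -- exactly when `m ≤ M`. What remains is the generator of the tail and, for `m > M`, an
  -- uncancelled term.
  have hsum : ∑ n ∈ Finset.range (M + 1),
      ((n : ℝ) * x ^ (n - 1) * (-b * lam) * (if m = n then 1 else 0) +
        x ^ n * branchingGenerator lam q (fun j => if j = n then 1 else 0) m) =
      (if m < M + 1 then 0 else (m : ℝ) * x ^ (m - 1) * (b * lam)) -
        branchingGenerator lam q (fun j => x ^ j - fM j) m := by
    rw [branchingGenerator_sub lam q hpow hfM1, branchingGenerator_pow hx0 hx1, ← hb, hfM,
      branchingGenerator_sum_mul (Finset.range (M + 1)) (fun n => x ^ n)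
        (fun n j => if j = n then (1 : ℝ) else 0) hite, Finset.sum_add_distrib]
    simp only [mul_ite, mul_one, mul_zero, Finset.sum_ite_eq, Finset.mem_range]
    split_ifs <;> ring
  rw [hsum]
  have h2 := abs_branchingGenerator_le hr0 hr1 hdiff lam q m
  rw [abs_of_nonneg hlam] at h2
  have h3 : |if m < M + 1 then 0 else (m : ℝ) * x ^ (m - 1) * (b * lam)| ≤
      1 / (1 - r) * r ^ M * lam := by
    split_ifs with h
    · simp only [abs_zero]
      positivity
    · rw [abs_mul, abs_mul, abs_mul, Nat.abs_cast, abs_of_nonneg (pow_nonneg hx0 _),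
        abs_of_nonneg hlam]
      calc (m : ℝ) * x ^ (m - 1) * (|b| * lam)
          ≤ (m : ℝ) * (r ^ (m - 1) * r ^ M) * (1 * lam) := by
            gcongr
            refine (hxpow _).trans ?_
            gcongr _ * ?_
            exact pow_le_pow_of_le_one hr0 hr1.le (by omega)
        _ = (m : ℝ) * r ^ (m - 1) * (r ^ M * lam) := by ring
        _ ≤ 1 / (1 - r) * (r ^ M * lam) := by
            gcongr
            exact nat_mul_pow_pred_le hr0 hr1 m
        _ = _ := by ring
  calc _ ≤ _ := abs_sub _ _
    _ ≤ 1 / (1 - r) * r ^ M * lam + 2 * r ^ M / (1 - r) * lam := add_le_add h3 h2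
    _ = _ := by ring

theorem measurable_branchingGenerator {lam : ℝ → ℝ} {p : ℝ → PMF ℕ} (hlam : Measurable lam)
    (hp : ∀ k, Measurable fun t => p t k) (hf : ∀ j, |f j| ≤ C) (n : ℕ) :
    Measurable fun u => branchingGenerator (lam u) (p u) f n := by
  refine (hlam.const_mul _).mul ?_
  refine measurable_of_tendsto_metrizable
    (f := fun N u => ∑ k ∈ Finset.range N, (p u k).toReal * (f (n + k - 1) - f n))
    (fun N => ?_) ?_
  · exact Finset.measurable_sum _ fun k _ => (hp k).ennreal_toReal.mul_const _
  · rw [tendsto_pi_nhds]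
    exact fun u => (summable_branchingGenerator (p u) hf n).hasSum.tendsto_sum_nat

end Generator

/-! ### Joint measurability of the paths -/

theorem measurable_uncurry_comp_nat {Ω S E : Type*} [MeasurableSpace Ω] [MeasurableSpace S]
    [MeasurableSpace E] {W : ℕ → Ω → E} (hW : ∀ k, Measurable (W k)) {F : S → ℕ}
    (hF : Measurable F) : Measurable fun x : S × Ω => W (F x.1) x.2 := by
  have h1 : Measurable fun y : ℕ × Ω => W y.1 y.2 := measurable_from_prod_countable_right hW
  exact h1.comp (g := fun y : ℕ × Ω => W y.1 y.2)
    ((hF.comp measurable_fst).prodMk measurable_snd)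

/-- A right-continuous `ℕ`-valued process is jointly measurable. -/
theorem measurable_uncurry_of_rightContinuous {Ω : Type*} [MeasurableSpace Ω]
    {Z : ℝ≥0 → Ω → ℕ} (hm : ∀ t, Measurable (Z t))
    (hc : ∀ ω t, ContinuousWithinAt (fun u => Z u ω) (Set.Ici t) t) :
    Measurable fun x : ℝ≥0 × Ω => Z x.1 x.2 := by
  -- The next grid point of mesh `1 / (N + 1)` after `t`: approach from the right with countably
  -- many values.
  let τ : ℕ → ℝ≥0 → ℝ≥0 := fun N t => (⌊(N + 1 : ℝ≥0) * t⌋₊ + 1 : ℝ≥0) / (N + 1)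
  have hle : ∀ N t, t ≤ τ N t := fun N t => by
    rw [le_div_iff₀ (by positivity), mul_comm]
    exact (Nat.lt_floor_add_one _).le
  have hge : ∀ N t, τ N t ≤ t + 1 / (N + 1) := fun N t => by
    have h : (t + 1 / (N + 1)) * (N + 1) = (N + 1) * t + 1 := by field_simp
    rw [div_le_iff₀ (by positivity), h]
    gcongr
    exact Nat.floor_le zero_le
  have hlim : ∀ t, Tendsto (fun N => τ N t) atTop (𝓝[Set.Ici t] t) := fun t => by
    refine tendsto_nhdsWithin_iff.2 ⟨?_, Eventually.of_forall fun N => hle N t⟩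
    refine tendsto_of_tendsto_of_tendsto_of_le_of_le tendsto_const_nhds ?_
      (fun N => hle N t) (fun N => hge N t)
    simpa using tendsto_const_nhds.add (tendsto_one_div_add_atTop_nhds_zero_nat (𝕜 := ℝ≥0))
  refine measurable_of_tendsto_metrizable (f := fun N (x : ℝ≥0 × Ω) => Z (τ N x.1) x.2)
    (fun N => ?_) ?_
  · have hmul : Measurable fun t : ℝ≥0 => (N + 1 : ℝ≥0) * t := measurable_const_mul _
    have hF : Measurable fun t : ℝ≥0 => ⌊(N + 1 : ℝ≥0) * t⌋₊ := hmul.nat_floor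
    have key := measurable_uncurry_comp_nat (W := fun k => Z ((k + 1 : ℝ≥0) / (N + 1)))
      (fun k => hm _) hF
    dsimp only [τ]
    exact key
  · rw [tendsto_pi_nhds]
    exact fun x => (hc x.2 x.1).tendsto.comp (hlim x.1)

/-- Puts point indicators within reach of `abs_branchingGenerator_le`, with `r = 1 / 2`. -/
theorem abs_ite_eq_le_geometric (n j : ℕ) :
    |if j = n then (1 : ℝ) else 0| ≤ 2 ^ n * (1 / 2) ^ j := by
  split_ifs with h
  · rw [h, ← mul_pow]
    norm_num
  · simp

/-! ### Forward equation and duality -/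

namespace IsMarkovBranchingProcess

variable {Ω : Type*} [MeasurableSpace Ω] {P : Measure Ω}
  {lam : ℝ → ℝ} {p : ℝ → PMF ℕ} {Z : ℝ≥0 → Ω → ℕ}

theorem measurable_uncurry_toNNReal (h : IsMarkovBranchingProcess P lam p Z) :
    Measurable fun x : ℝ × Ω => Z x.1.toNNReal x.2 :=
  (measurable_uncurry_of_rightContinuous h.measurable h.right_continuous).comp
    ((measurable_real_toNNReal.comp measurable_fst).prodMk measurable_snd)

theorem measurable_generator (h : IsMarkovBranchingProcess P lam p Z) (n : ℕ) :
    Measurable fun x : ℝ × Ω => branchingGenerator (lam x.1) (p x.1)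
      (fun j => if j = n then 1 else 0) (Z x.1.toNNReal x.2) := by
  have h1 : Measurable fun y : ℝ × ℕ => branchingGenerator (lam y.1) (p y.1)
      (fun j => if j = n then 1 else 0) y.2 :=
    measurable_from_prod_countable_left fun m => measurable_branchingGenerator (C := 1)
      h.rate_measurable h.offspring_measurable (fun j => by split_ifs <;> simp) m
  exact h1.comp (measurable_fst.prodMk h.measurable_uncurry_toNNReal)

theorem abs_generator_le (n m : ℕ) (u : ℝ) :
    |branchingGenerator (lam u) (p u) (fun j => if j = n then 1 else 0) m| ≤
      2 * 2 ^ n / (1 - 1 / 2) * |lam u| :=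
  abs_branchingGenerator_le (by norm_num) (by norm_num) (abs_ite_eq_le_geometric n) _ _ m

variable [IsProbabilityMeasure P]

theorem integrable_generator (h : IsMarkovBranchingProcess P lam p Z) (n : ℕ) (u : ℝ) :
    Integrable (fun ω => branchingGenerator (lam u) (p u)
      (fun j => if j = n then 1 else 0) (Z u.toNNReal ω)) P := by
  refine Integrable.of_bound (C := 2 * 2 ^ n / (1 - 1 / 2) * |lam u|)
    ((h.measurable_generator n).comp measurable_prodMk_left).aestronglyMeasurable ?_
  exact ae_of_all _ fun ω => abs_generator_le n _ u

theorem integrable_uncurry_generator (h : IsMarkovBranchingProcess P lam p Z) (n : ℕ) {t : ℝ}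
    (ht : 0 ≤ t) :
    Integrable (Function.uncurry fun (u : ℝ) (ω : Ω) => branchingGenerator (lam u) (p u)
      (fun j => if j = n then 1 else 0) (Z u.toNNReal ω))
      ((volume.restrict (Set.uIoc 0 t)).prod P) := by
  have h1 : Integrable (fun x : ℝ × Ω => 2 * 2 ^ n / (1 - 1 / 2) * |lam x.1|)
      ((volume.restrict (Set.uIoc 0 t)).prod P) :=
    (((h.rate_integrable t ht).def'.abs).const_mul (2 * 2 ^ n / (1 - 1 / 2))).comp_fst P
  exact h1.mono' (h.measurable_generator n).aestronglyMeasurable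
    (ae_of_all _ fun x => abs_generator_le n _ x.1)

theorem intervalIntegrable_integral_generator (h : IsMarkovBranchingProcess P lam p Z) (n : ℕ)
    {t : ℝ} (ht : 0 ≤ t) :
    IntervalIntegrable (fun u => ∫ ω, branchingGenerator (lam u) (p u)
      (fun j => if j = n then 1 else 0) (Z u.toNNReal ω) ∂P) volume 0 t := by
  rw [intervalIntegrable_iff]
  exact (h.integrable_uncurry_generator n ht).integral_prod_left

/-- The forward equation for the law of `Z`, in integrated form. -/
theorem measureReal_eq (h : IsMarkovBranchingProcess P lam p Z) (n : ℕ) (t : ℝ≥0) :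
    P.real {ω | Z t ω = n} = (if 1 = n then 1 else 0) +
      ∫ u in (0 : ℝ)..t, ∫ ω, branchingGenerator (lam u) (p u)
        (fun j => if j = n then 1 else 0) (Z u.toNNReal ω) ∂P := by
  set f : ℕ → ℝ := fun j => if j = n then 1 else 0 with hf
  have hM := h.martingale f ((Set.finite_singleton n).subset fun j hj => by
    by_contra hne
    exact hj (if_neg hne))
  -- The martingale vanishes at time `0`, so its mean at time `t` is zero; Fubini then exchanges `E`
  -- and the time integral.
  have hconst := integral_congr_ae (hM.2 0 t zero_le)
  rw [integral_condExp] at hconst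
  have hfint : ∀ s, Integrable (fun ω => f (Z s ω)) P := fun s =>
    Integrable.of_bound (C := 1)
      ((measurable_of_countable f).comp (h.measurable s)).aestronglyMeasurable
      (ae_of_all _ fun ω => by simp only [hf]; split_ifs <;> simp)
  have hf0 : ∫ ω, f (Z 0 ω) ∂P = if 1 = n then 1 else 0 := by
    have : (fun ω => f (Z 0 ω)) =ᵐ[P] fun _ => f 1 := by
      filter_upwards [h.initial] with ω hω
      rw [hω]
    rw [integral_congr_ae this]
    simp [hf]
  have hft : ∫ ω, f (Z t ω) ∂P = P.real {ω | Z t ω = n} := by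
    have hmeas : MeasurableSet {ω | Z t ω = n} := h.measurable t (measurableSet_singleton n)
    rw [← integral_indicator_one hmeas]
    refine integral_congr_ae (ae_of_all _ fun ω => ?_)
    simp [hf, Set.indicator_apply]
  have hIint := (h.integrable_uncurry_generator n t.coe_nonneg).integral_prod_right
  have hswap := intervalIntegral_integral_swap (h.integrable_uncurry_generator n t.coe_nonneg)
  have hIint' : Integrable (fun ω => ∫ u in (0 : ℝ)..t,
      branchingGenerator (lam u) (p u) f (Z u.toNNReal ω)) P := by
    refine hIint.congr (ae_of_all _ fun ω => ?_)
    simp only [intervalIntegral.integral_of_le t.coe_nonneg, Set.uIoc_of_le t.coe_nonneg,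
      Function.uncurry_apply_pair, hf]
  have hsplit : ∫ ω, (f (Z t ω) - f (Z 0 ω) - ∫ u in (0 : ℝ)..t,
      branchingGenerator (lam u) (p u) f (Z u.toNNReal ω)) ∂P = 0 := by
    simpa only [NNReal.coe_zero, intervalIntegral.integral_same, sub_self, integral_zero]
      using hconst
  rw [integral_sub (f := fun ω => f (Z t ω) - f (Z 0 ω)) ((hfint t).sub (hfint 0)) hIint',
    integral_sub (hfint t) (hfint 0), hft, hf0, ← hswap] at hsplit
  linarith

/-- The law of `Z_t` as an absolutely continuous function of the real variable `t`. -/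
noncomputable def _root_.occupation {Ω : Type*} [MeasurableSpace Ω] (P : Measure Ω)
    (lam : ℝ → ℝ) (p : ℝ → PMF ℕ) (Z : ℝ≥0 → Ω → ℕ) (n : ℕ) (t : ℝ) : ℝ :=
  (if 1 = n then 1 else 0) +
    ∫ u in (0 : ℝ)..t, ∫ ω, branchingGenerator (lam u) (p u)
      (fun j => if j = n then 1 else 0) (Z u.toNNReal ω) ∂P

theorem occupation_eq (h : IsMarkovBranchingProcess P lam p Z) (n : ℕ) {t : ℝ} (ht : 0 ≤ t) :
    occupation P lam p Z n t = ∫ ω, (if Z t.toNNReal ω = n then (1 : ℝ) else 0) ∂P := by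
  have hmeas : MeasurableSet {ω | Z t.toNNReal ω = n} :=
    h.measurable _ (measurableSet_singleton n)
  have h1 := h.measureReal_eq n t.toNNReal
  rw [Real.coe_toNNReal t ht] at h1
  rw [occupation, ← h1, ← integral_indicator_one hmeas]
  refine integral_congr_ae (ae_of_all _ fun ω => ?_)
  simp [Set.indicator_apply]

theorem hasACDeriv_occupation (h : IsMarkovBranchingProcess P lam p Z) (n : ℕ) {T : ℝ}
    (hT : 0 ≤ T) :
    HasACDeriv T (occupation P lam p Z n) (fun u => ∫ ω, branchingGenerator (lam u) (p u)
      (fun j => if j = n then 1 else 0) (Z u.toNNReal ω) ∂P) :=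
  ((HasACDeriv.const _).add
    (HasACDeriv.integral (h.intervalIntegrable_integral_generator n hT))).congr_deriv
    fun _ _ => zero_add _

theorem integrable_pow (h : IsMarkovBranchingProcess P lam p Z) (t : ℝ≥0) {x : ℝ} (hx0 : 0 ≤ x)
    (hx1 : x ≤ 1) : Integrable (fun ω => x ^ Z t ω) P :=
  Integrable.of_bound (C := 1)
    ((measurable_of_countable fun n => x ^ n).comp (h.measurable t)).aestronglyMeasurable
    (ae_of_all _ fun ω => by
      rw [Real.norm_eq_abs, abs_of_nonneg (pow_nonneg hx0 _)]
      exact pow_le_one₀ hx0 hx1)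

theorem integrable_ite (h : IsMarkovBranchingProcess P lam p Z) (t : ℝ≥0) (n : ℕ) :
    Integrable (fun ω => if Z t ω = n then (1 : ℝ) else 0) P :=
  Integrable.of_bound (C := 1)
    ((measurable_of_countable fun m => if m = n then (1 : ℝ) else 0).comp
      (h.measurable t)).aestronglyMeasurable
    (ae_of_all _ fun ω => by split_ifs <;> simp)

/-- Duality: `E s ^ Z_T` is the value at time `0` of the solution of the backward equation with
terminal value `s`. -/
theorem integral_pow_eq_of_backward (h : IsMarkovBranchingProcess P lam p Z) (T : ℝ≥0)
    {φ : ℝ → ℝ} {ρ : ℝ} (hρ0 : 0 < ρ) (hρ1 : ρ < 1)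
    (hφ : ∀ u : ℝ, 0 ≤ u → u ≤ T → 0 ≤ φ u ∧ φ u ≤ ρ)
    (hφ' : HasACDeriv T φ fun u => -(probGenFun (p u) (φ u) - φ u) * lam u) :
    ∫ ω, φ T ^ Z T ω ∂P = φ 0 := by
  have hT : (0 : ℝ) ≤ T := T.coe_nonneg
  -- The square root splits `ρ ^ n` into the two geometric factors used in the truncation estimate.
  set r := Real.sqrt ρ with hr
  have hr0 : 0 ≤ r := Real.sqrt_nonneg ρ
  have hr1 : r < 1 := by
    rw [hr, Real.sqrt_lt' one_pos]
    simpa using hρ1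
  have hr2 : r ^ 2 = ρ := Real.sq_sqrt hρ0.le
  -- Truncation of `E φ_u ^ Z_u`, which would be constant in `u` without the cutoff.
  let ψ : ℕ → ℝ → ℝ := fun M u =>
    ∑ n ∈ Finset.range (M + 1), φ u ^ n * occupation P lam p Z n u
  have hψ : ∀ M, HasACDeriv T (ψ M) fun u => ∑ n ∈ Finset.range (M + 1),
      (n * φ u ^ (n - 1) * (-(probGenFun (p u) (φ u) - φ u) * lam u) *
          occupation P lam p Z n u +
        φ u ^ n * ∫ ω, branchingGenerator (lam u) (p u)
          (fun j => if j = n then 1 else 0) (Z u.toNNReal ω) ∂P) := fun M =>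
    HasACDeriv.sum _ fun n _ => (hφ'.pow n).mul (h.hasACDeriv_occupation n hT)
  have hbound : ∀ M, |ψ M T - ψ M 0| ≤ 3 / (1 - r) * r ^ M * ∫ u in (0 : ℝ)..T, lam u := by
    intro M
    rw [← intervalIntegral.integral_const_mul]
    refine (hψ M).abs_sub_le hT ((h.rate_integrable T hT).const_mul _)
      (ae_of_all _ fun u hu _ => ?_)
    have hint : ∀ n ∈ Finset.range (M + 1), Integrable (fun ω =>
        (n : ℝ) * φ u ^ (n - 1) * (-(probGenFun (p u) (φ u) - φ u) * lam u) *
          (if Z u.toNNReal ω = n then (1 : ℝ) else 0) +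
        φ u ^ n * branchingGenerator (lam u) (p u)
          (fun j => if j = n then 1 else 0) (Z u.toNNReal ω)) P := fun n _ =>
      ((h.integrable_ite _ n).const_mul _).add ((h.integrable_generator n u).const_mul _)
    have heq : ∑ n ∈ Finset.range (M + 1),
        (n * φ u ^ (n - 1) * (-(probGenFun (p u) (φ u) - φ u) * lam u) *
            occupation P lam p Z n u +
          φ u ^ n * ∫ ω, branchingGenerator (lam u) (p u)
            (fun j => if j = n then 1 else 0) (Z u.toNNReal ω) ∂P) =
        ∫ ω, ∑ n ∈ Finset.range (M + 1),
          ((n : ℝ) * φ u ^ (n - 1) * (-(probGenFun (p u) (φ u) - φ u) * lam u) *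
            (if Z u.toNNReal ω = n then (1 : ℝ) else 0) +
          φ u ^ n * branchingGenerator (lam u) (p u)
            (fun j => if j = n then 1 else 0) (Z u.toNNReal ω)) ∂P := by
      rw [integral_finsetSum _ hint]
      refine Finset.sum_congr rfl fun n _ => ?_
      rw [integral_add ((h.integrable_ite _ n).const_mul _)
        ((h.integrable_generator n u).const_mul _), integral_const_mul, integral_const_mul,
        h.occupation_eq n hu.1]
    rw [heq, ← Real.norm_eq_abs]
    refine (norm_integral_le_of_norm_le_const (ae_of_all _ fun ω =>
      abs_truncated_generator_le hr0 hr1 (hφ u hu.1 hu.2).1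
        ((hφ u hu.1 hu.2).2.trans hr2.ge) (h.rate_nonneg u hu.1) (p u) M _)).trans ?_
    simp
  -- The cutoff must retain the initial state `1`.
  have hψ0 : ∀ M, 1 ≤ M → ψ M 0 = φ 0 := fun M hM => by
    simp [ψ, occupation, show M ≠ 0 by omega]
  have hψT : ∀ M, |∫ ω, φ T ^ Z T ω ∂P - ψ M T| ≤ r ^ M := by
    intro M
    obtain ⟨h0, h1⟩ := hφ T hT le_rfl
    have heq : ψ M T = ∫ ω, ∑ n ∈ Finset.range (M + 1),
        φ T ^ n * (if Z T ω = n then (1 : ℝ) else 0) ∂P := by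
      rw [integral_finsetSum _ fun n _ => (h.integrable_ite T n).const_mul _]
      refine Finset.sum_congr rfl fun n _ => ?_
      rw [integral_const_mul, h.occupation_eq n hT, Real.toNNReal_coe]
    rw [heq, ← integral_sub (h.integrable_pow T h0 (h1.trans hρ1.le))
      (integrable_finsetSum _ fun n _ => (h.integrable_ite T n).const_mul _),
      ← Real.norm_eq_abs]
    refine (norm_integral_le_of_norm_le_const (C := r ^ M) (ae_of_all _ fun ω => ?_)).trans
      (by simp)
    simp only [mul_ite, mul_one, mul_zero, Finset.sum_ite_eq, Finset.mem_range]
    split_ifs with hlt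
    · simpa using pow_nonneg hr0 M
    · rw [sub_zero, Real.norm_eq_abs, abs_of_nonneg (pow_nonneg h0 _)]
      calc φ T ^ Z T ω ≤ (r ^ 2) ^ Z T ω := by
            gcongr
            exact h1.trans hr2.ge
        _ = r ^ (2 * Z T ω) := (pow_mul _ _ _).symm
        _ ≤ r ^ M := pow_le_pow_of_le_one hr0 hr1.le (by omega)
  have hlim : Tendsto (fun M => r ^ M + 3 / (1 - r) * r ^ M * ∫ u in (0 : ℝ)..T, lam u)
      atTop (𝓝 0) := by
    have h1 := tendsto_pow_atTop_nhds_zero_of_lt_one hr0 hr1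
    simpa using h1.add ((h1.const_mul (3 / (1 - r))).mul_const _)
  have hle : |∫ ω, φ T ^ Z T ω ∂P - φ 0| ≤ 0 := by
    refine ge_of_tendsto hlim (eventually_atTop.2 ⟨1, fun M hM => ?_⟩)
    rw [← hψ0 M hM]
    exact (abs_sub_le _ (ψ M T) _).trans (add_le_add (hψT M) (hbound M))
  exact sub_eq_zero.1 (abs_nonpos_iff.1 hle)

end IsMarkovBranchingProcess

/-! ### Asymptotics of the environment -/

section Environment

variable {θ : ℝ} {lam a : ℝ → ℝ}

theorem intervalIntegrable_of_integrableOn_Ioi {f : ℝ → ℝ} (hf : IntegrableOn f (Set.Ioi 0))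
    {t : ℝ} (ht : 0 ≤ t) : IntervalIntegrable f volume 0 t := by
  rw [intervalIntegrable_iff_integrableOn_Ioc_of_le ht]
  exact hf.mono_set Set.Ioc_subset_Ioi_self

/-- `D_t` is `Λ_t` minus a partial integral of `a λ`, which lies between `0` and the total integral.
-/
theorem netDeath_sub_le (hlam : ∀ t : ℝ, 0 ≤ t → IntervalIntegrable lam volume 0 t)
    (halam : IntegrableOn (fun u => a u * lam u) (Set.Ioi 0))
    (hlam0 : ∀ t, 0 ≤ t → 0 ≤ lam t) (ha0 : ∀ t, 0 ≤ t → 0 ≤ a t)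
    {u t : ℝ} (hu : 0 ≤ u) (hut : u ≤ t) :
    netDeath lam a u - netDeath lam a t ≤
      (cumulativeHazard lam u - cumulativeHazard lam t) + ∫ v in Set.Ioi 0, a v * lam v := by
  have ht := hu.trans hut
  have hD : ∀ s : ℝ, 0 ≤ s → netDeath lam a s =
      cumulativeHazard lam s - ∫ v in (0 : ℝ)..s, a v * lam v := fun s hs => by
    rw [netDeath, cumulativeHazard, ← intervalIntegral.integral_sub (hlam s hs)
      (intervalIntegrable_of_integrableOn_Ioi halam hs)]
    exact intervalIntegral.integral_congr fun v _ => by ring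
  have hnn : ∀ v : ℝ, 0 ≤ v → 0 ≤ a v * lam v := fun v hv => mul_nonneg (ha0 v hv) (hlam0 v hv)
  have h1 : ∫ v in (0 : ℝ)..t, a v * lam v ≤ ∫ v in Set.Ioi 0, a v * lam v := by
    rw [intervalIntegral.integral_of_le ht]
    refine setIntegral_mono_set halam ?_ Set.Ioc_subset_Ioi_self.eventuallyLE
    filter_upwards [ae_restrict_mem measurableSet_Ioi] with v hv
    exact hnn v (le_of_lt hv)
  have h2 : 0 ≤ ∫ v in (0 : ℝ)..u, a v * lam v :=
    intervalIntegral.integral_nonneg hu fun v hv => hnn v hv.1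
  rw [hD u hu, hD t ht]
  linarith

theorem cumulativeHazard_mono (hlam : ∀ t : ℝ, 0 ≤ t → IntervalIntegrable lam volume 0 t)
    (hlam0 : ∀ t, 0 ≤ t → 0 ≤ lam t) {u t : ℝ} (hu : 0 ≤ u) (hut : u ≤ t) :
    cumulativeHazard lam u ≤ cumulativeHazard lam t :=
  (HasACDeriv.integral (hlam t (hu.trans hut))).le_of_deriv_nonneg hu hut
    fun v hv _ => hlam0 v hv

theorem tendsto_netDeath (hlam : ∀ t : ℝ, 0 ≤ t → IntervalIntegrable lam volume 0 t)
    (halam : IntegrableOn (fun u => a u * lam u) (Set.Ioi 0))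
    (hlam0 : ∀ t, 0 ≤ t → 0 ≤ lam t) (ha0 : ∀ t, 0 ≤ t → 0 ≤ a t)
    (hLam : Tendsto (cumulativeHazard lam) atTop atTop) :
    Tendsto (netDeath lam a) atTop atTop := by
  refine tendsto_atTop_mono' atTop ?_
    (tendsto_atTop_add_const_right atTop (-∫ v in Set.Ioi 0, a v * lam v) hLam)
  filter_upwards [eventually_ge_atTop 0] with t ht
  have h := netDeath_sub_le hlam halam hlam0 ha0 le_rfl ht
  simp only [netDeath, cumulativeHazard, intervalIntegral.integral_same] at h ⊢
  linarith

theorem weightedBirth_nonneg (hlam0 : ∀ t, 0 ≤ t → 0 ≤ lam t) (ha0 : ∀ t, 0 ≤ t → 0 ≤ a t)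
    {t : ℝ} (ht : 0 ≤ t) : 0 ≤ weightedBirth θ lam a t :=
  intervalIntegral.integral_nonneg ht fun v hv =>
    mul_nonneg (mul_nonneg (ha0 v hv.1) (hlam0 v hv.1)) (Real.exp_pos _).le

/-- The product is the integral of `a_u λ_u exp (θ (D_u - D_t))` over `u ≤ t`. Since `D_u - D_t` is
at most the total integral `I` of `a λ`, the integrand is dominated by `a λ exp (θ I)`, and it
vanishes pointwise as `D_t → ∞`. -/
theorem tendsto_weightedBirth_mul_exp (hθ : 0 < θ)
    (hlam : ∀ t : ℝ, 0 ≤ t → IntervalIntegrable lam volume 0 t)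
    (halam : IntegrableOn (fun u => a u * lam u) (Set.Ioi 0))
    (hlam0 : ∀ t, 0 ≤ t → 0 ≤ lam t) (ha0 : ∀ t, 0 ≤ t → 0 ≤ a t)
    (hLam : Tendsto (cumulativeHazard lam) atTop atTop) :
    Tendsto (fun t => weightedBirth θ lam a t * Real.exp (-θ * netDeath lam a t)) atTop (𝓝 0) := by
  set I := ∫ v in Set.Ioi 0, a v * lam v
  let F : ℝ → ℝ → ℝ := fun t u => (Set.Ioc 0 t).indicator (fun u =>
    a u * lam u * Real.exp (θ * netDeath lam a u) * Real.exp (-θ * netDeath lam a t)) u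
  have hD := tendsto_netDeath hlam halam hlam0 ha0 hLam
  have heq : ∀ᶠ t in atTop, ∫ u in Set.Ioi 0, F t u =
      weightedBirth θ lam a t * Real.exp (-θ * netDeath lam a t) := by
    filter_upwards [eventually_ge_atTop 0] with t ht
    rw [setIntegral_indicator measurableSet_Ioc,
      Set.inter_eq_right.2 Set.Ioc_subset_Ioi_self, integral_mul_const, weightedBirth,
      intervalIntegral.integral_of_le ht]
  refine Tendsto.congr' heq ?_
  have h0 : ∫ _ in Set.Ioi (0 : ℝ), (0 : ℝ) = 0 := by simp
  suffices h : Tendsto (fun t => ∫ u in Set.Ioi 0, F t u) atTop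
      (𝓝 (∫ _ in Set.Ioi (0 : ℝ), (0 : ℝ))) by rwa [h0] at h
  refine tendsto_integral_filter_of_dominated_convergence (l := atTop) (F := F)
    (fun u => a u * lam u * Real.exp (θ * I)) ?_ ?_ (halam.mul_const _) ?_
  · filter_upwards [eventually_ge_atTop 0] with t ht
    rw [aestronglyMeasurable_indicator_iff measurableSet_Ioc,
      Measure.restrict_restrict measurableSet_Ioc,
      Set.inter_eq_left.2 Set.Ioc_subset_Ioi_self]
    have hint : IntervalIntegrable (fun u => a u * lam u * Real.exp (θ * netDeath lam a u))
        volume 0 t :=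
      (intervalIntegrable_of_integrableOn_Ioi halam ht).mul_continuousOn
        (hasACDeriv_exp_netDeath θ (hlam t ht)
          (intervalIntegrable_of_integrableOn_Ioi halam ht)).1.continuousOn
    exact hint.aestronglyMeasurable.mul_const _
  · refine Eventually.of_forall fun t => ?_
    filter_upwards [ae_restrict_mem measurableSet_Ioi] with u hu
    have hu0 : 0 ≤ u := le_of_lt hu
    have hnn : 0 ≤ a u * lam u := mul_nonneg (ha0 u hu0) (hlam0 u hu0)
    simp only [F, Set.indicator_apply]
    split_ifs with hut
    · have h1 := netDeath_sub_le hlam halam hlam0 ha0 hu0 hut.2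
      have h2 := cumulativeHazard_mono hlam hlam0 hu0 hut.2
      rw [mul_assoc, ← Real.exp_add, Real.norm_eq_abs,
        abs_of_nonneg (mul_nonneg hnn (Real.exp_pos _).le)]
      gcongr
      have h3 : netDeath lam a u - netDeath lam a t ≤ I := by linarith
      nlinarith
    · simp only [norm_zero]
      positivity
  · filter_upwards [ae_restrict_mem measurableSet_Ioi] with u hu
    have hexp : Tendsto (fun t => a u * lam u * Real.exp (θ * netDeath lam a u) *
        Real.exp (-θ * netDeath lam a t)) atTop (𝓝 0) := by
      have h1 : Tendsto (fun t => -θ * netDeath lam a t) atTop atBot :=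
        hD.const_mul_atTop_of_neg (by linarith)
      simpa using (Real.tendsto_exp_atBot.comp h1).const_mul
        (a u * lam u * Real.exp (θ * netDeath lam a u))
    refine hexp.congr' ?_
    filter_upwards [eventually_ge_atTop u] with t ht
    simp only [F]
    rw [Set.indicator_of_mem]
    exact ⟨hu, ht⟩

end Environment

/-! ### From generating functions to means -/

/-- The quotient `(1 - s ^ X) / (1 - s)` is a geometric sum with `X` terms, tending to `X` as `s →
1`; Fatou's lemma transfers the bound without assuming that `X` is integrable. -/
theorem lintegral_natCast_le_of_integral_pow {Ω : Type*} [MeasurableSpace Ω] {P : Measure Ω}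
    [IsProbabilityMeasure P] {X : Ω → ℕ} (hX : Measurable X) {m : ℝ}
    (h : ∀ s : ℝ, 0 ≤ s → s < 1 → 1 - ∫ ω, s ^ X ω ∂P ≤ (1 - s) * m) :
    ∫⁻ ω, (X ω : ℝ≥0∞) ∂P ≤ ENNReal.ofReal m := by
  let σ : ℕ → ℝ := fun k => 1 - 1 / (k + 1)
  have hσ1 : ∀ k, σ k < 1 := fun k => by
    have : (0 : ℝ) < 1 / (k + 1) := by positivity
    simp only [σ]
    linarith
  have hσ0 : ∀ k, 0 ≤ σ k := fun k => by
    have : (1 : ℝ) / (k + 1) ≤ 1 := by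
      rw [div_le_one (by positivity)]
      linarith [(Nat.cast_nonneg k : (0 : ℝ) ≤ k)]
    simp only [σ]
    linarith
  have hσ : Tendsto σ atTop (𝓝 1) := by
    simpa [σ] using (tendsto_const_nhds (x := (1 : ℝ))).sub (tendsto_one_div_add_atTop_nhds_zero_nat (𝕜 := ℝ))
  let F : ℕ → Ω → ℝ := fun k ω => ∑ i ∈ Finset.range (X ω), σ k ^ i
  have hF0 : ∀ k ω, 0 ≤ F k ω := fun k ω => Finset.sum_nonneg fun i _ => pow_nonneg (hσ0 k) i
  have hFm : ∀ k, Measurable (F k) := fun k =>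
    (measurable_of_countable fun n => ∑ i ∈ Finset.range n, σ k ^ i).comp hX
  have hF : ∀ k ω, F k ω = (1 - σ k)⁻¹ * (1 - σ k ^ X ω) := fun k ω => by
    have h1 : 1 - σ k ≠ 0 := (sub_pos.2 (hσ1 k)).ne'
    have h2 := geom_sum_mul (σ k) (X ω)
    rw [eq_inv_mul_iff_mul_eq₀ h1]
    simp only [F]
    linear_combination -h2
  have hpow : ∀ k, Integrable (fun ω => σ k ^ X ω) P := fun k =>
    Integrable.of_bound (C := 1)
      ((measurable_of_countable fun n => σ k ^ n).comp hX).aestronglyMeasurable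
      (ae_of_all _ fun ω => by
        rw [Real.norm_eq_abs, abs_of_nonneg (pow_nonneg (hσ0 k) _)]
        exact pow_le_one₀ (hσ0 k) (hσ1 k).le)
  have hle : ∀ k, ∫⁻ ω, ENNReal.ofReal (F k ω) ∂P ≤ ENNReal.ofReal m := fun k => by
    have hpos : 0 < 1 - σ k := sub_pos.2 (hσ1 k)
    have hint : Integrable (F k) P := by
      rw [show F k = fun ω => (1 - σ k)⁻¹ * (1 - σ k ^ X ω) from funext (hF k)]
      exact ((integrable_const 1).sub (hpow k)).const_mul _
    rw [← ofReal_integral_eq_lintegral_ofReal hint (ae_of_all _ (hF0 k))]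
    refine ENNReal.ofReal_le_ofReal ?_
    rw [integral_congr_ae (ae_of_all _ (hF k)), integral_const_mul,
      integral_sub (integrable_const 1) (hpow k), inv_mul_le_iff₀ hpos]
    simpa using h (σ k) (hσ0 k) (hσ1 k)
  have hlim : ∀ ω, liminf (fun k => ENNReal.ofReal (F k ω)) atTop = (X ω : ℝ≥0∞) := fun ω => by
    have h1 : Tendsto (fun k => F k ω) atTop (𝓝 (X ω : ℝ)) := by
      have : Tendsto (fun k => F k ω) atTop (𝓝 (∑ i ∈ Finset.range (X ω), (1 : ℝ) ^ i)) :=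
        tendsto_finsetSum _ fun i _ => hσ.pow i
      simpa using this
    have h2 := (ENNReal.tendsto_ofReal h1).liminf_eq
    rwa [ENNReal.ofReal_natCast] at h2
  calc ∫⁻ ω, (X ω : ℝ≥0∞) ∂P
      = ∫⁻ ω, liminf (fun k => ENNReal.ofReal (F k ω)) atTop ∂P := by simp only [hlim]
    _ ≤ liminf (fun k => ∫⁻ ω, ENNReal.ofReal (F k ω) ∂P) atTop :=
        lintegral_liminf_le fun k => (hFm k).ennreal_ofReal
    _ ≤ liminf (fun _ : ℕ => ENNReal.ofReal m) atTop :=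
        liminf_le_liminf (Eventually.of_forall hle)
    _ = ENNReal.ofReal m := liminf_const _

section SurvivalMean

variable {Ω : Type*} [MeasurableSpace Ω] {P : Measure Ω} {Z : ℝ≥0 → Ω → ℕ} {t : ℝ≥0}

theorem measurableSet_survival (hZ : Measurable (Z t)) : MeasurableSet {ω | 0 < Z t ω} :=
  hZ (Set.to_countable (Set.Ioi 0)).measurableSet

theorem one_le_survivalMean [IsFiniteMeasure P] (hZ : Measurable (Z t)) (hpos : P {ω | 0 < Z t ω} ≠ 0) :
    1 ≤ survivalMean P Z t := by
  have := cond_isProbabilityMeasure hpos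
  have h1 : ∫⁻ _, 1 ∂(P[|{ω | 0 < Z t ω}]) = 1 := by simp
  rw [← h1, survivalMean]
  refine lintegral_mono_ae ?_
  filter_upwards [ae_cond_mem (measurableSet_survival hZ)] with ω hω
  exact_mod_cast Nat.one_le_iff_ne_zero.2 (Nat.pos_iff_ne_zero.1 hω)

theorem survivalMean_le :
    survivalMean P Z t ≤ (P {ω | 0 < Z t ω})⁻¹ * ∫⁻ ω, (Z t ω : ℝ≥0∞) ∂P := by
  rw [survivalMean, ProbabilityTheory.cond, lintegral_smul_measure, smul_eq_mul]
  gcongr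
  exact Measure.restrict_le_self

end SurvivalMean

/-! ### Explicit formulas for the theta-positive process -/

namespace IsThetaPositiveBranchingProcess

variable {Ω : Type*} [MeasurableSpace Ω] {P : Measure Ω} [IsProbabilityMeasure P]
  {θ : ℝ} {lam a : ℝ → ℝ} {Z : ℝ≥0 → Ω → ℕ}

theorem integral_pow_eq (hZ : IsThetaPositiveBranchingProcess P θ lam a Z)
    (ha : IntegrableOn (fun u => a u * lam u) (Set.Ioi 0)) (t : ℝ≥0) {s : ℝ} (hs0 : 0 ≤ s)
    (hs1 : s < 1) :
    ∫ ω, s ^ Z t ω ∂P = 1 - ((1 - s) ^ (-θ) * Real.exp (θ * netDeath lam a t) +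
      θ / (1 + θ) * weightedBirth θ lam a t) ^ (-(1 / θ)) := by
  obtain ⟨p, hp, hgen⟩ := hZ.branching
  have ht : (0 : ℝ) ≤ t := t.coe_nonneg
  have hlam := hp.rate_integrable t ht
  have halam := intervalIntegrable_of_integrableOn_Ioi ha ht
  obtain ⟨ρ, hρ0, hρ1, hφ⟩ := backwardPGF_mem hZ.theta_pos hs0 hs1 ht hlam halam
    hp.rate_nonneg hZ.mean_le
  have hφ' := hasACDeriv_backwardPGF hZ.theta_pos hs0 hs1 ht hlam halam hp.rate_nonneg hZ.mean_le
  have h := hp.integral_pow_eq_of_backward t hρ0 hρ1 hφ (hφ'.congr_deriv fun u hu => by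
    rw [Set.uIcc_of_le ht] at hu
    obtain ⟨h0, h1⟩ := hφ u hu.1 hu.2
    rw [hgen u hu.1 _ ⟨h0, h1.trans hρ1.le⟩])
  rwa [backwardPGF_terminal hZ.theta_pos hs1, backwardPGF_zero] at h

theorem measureReal_extinct (hZ : IsThetaPositiveBranchingProcess P θ lam a Z)
    (ha : IntegrableOn (fun u => a u * lam u) (Set.Ioi 0)) (t : ℝ≥0) :
    P.real {ω | Z t ω = 0} = 1 - (Real.exp (θ * netDeath lam a t) +
      θ / (1 + θ) * weightedBirth θ lam a t) ^ (-(1 / θ)) := by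
  obtain ⟨p, hp, -⟩ := hZ.branching
  -- With `0 ^ 0 = 1`, the power `0 ^ Z_t` is the indicator of extinction.
  have h := hZ.integral_pow_eq ha t le_rfl one_pos
  rw [sub_zero, Real.one_rpow, one_mul] at h
  have hmeas : MeasurableSet {ω | Z t ω = 0} := hp.measurable t (measurableSet_singleton 0)
  rw [← h, ← integral_indicator_one hmeas]
  refine integral_congr_ae (ae_of_all _ fun ω => ?_)
  simp [Set.indicator_apply, zero_pow_eq]

theorem measure_survival (hZ : IsThetaPositiveBranchingProcess P θ lam a Z)
    (ha : IntegrableOn (fun u => a u * lam u) (Set.Ioi 0)) (t : ℝ≥0) :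
    P {ω | 0 < Z t ω} = ENNReal.ofReal ((Real.exp (θ * netDeath lam a t) +
      θ / (1 + θ) * weightedBirth θ lam a t) ^ (-(1 / θ))) := by
  obtain ⟨p, hp, -⟩ := hZ.branching
  have hmeas : MeasurableSet {ω | Z t ω = 0} := hp.measurable t (measurableSet_singleton 0)
  have hcompl : {ω | 0 < Z t ω} = {ω | Z t ω = 0}ᶜ := by
    ext ω
    simp [Nat.pos_iff_ne_zero]
  have h := probReal_compl_eq_one_sub (μ := P) hmeas
  rw [hZ.measureReal_extinct ha t, sub_sub_cancel] at h
  rw [hcompl, ← h, ofReal_measureReal]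

/-- Dropping the nonnegative birth term from the generating function leaves exactly `(1 - s) exp
(-D_t)`. -/
theorem lintegral_le (hZ : IsThetaPositiveBranchingProcess P θ lam a Z)
    (ha : IntegrableOn (fun u => a u * lam u) (Set.Ioi 0)) (t : ℝ≥0) :
    ∫⁻ ω, (Z t ω : ℝ≥0∞) ∂P ≤ ENNReal.ofReal (Real.exp (-netDeath lam a t)) := by
  obtain ⟨p, hp, -⟩ := hZ.branching
  have hθ := hZ.theta_pos
  refine lintegral_natCast_le_of_integral_pow (hp.measurable t) fun s hs0 hs1 => ?_
  have h1s : 0 < 1 - s := by linarith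
  rw [hZ.integral_pow_eq ha t hs0 hs1, sub_sub_cancel]
  have hJ := weightedBirth_nonneg (θ := θ) hp.rate_nonneg hZ.mean_nonneg t.coe_nonneg
  have hκ := Real.rpow_pos_of_pos h1s (-θ)
  have hexp := Real.exp_pos (θ * netDeath lam a t)
  have hmul : -θ * -(1 / θ) = 1 := by field_simp
  have hmul' : θ * netDeath lam a t * -(1 / θ) = -netDeath lam a t := by field_simp
  calc _ ≤ ((1 - s) ^ (-θ) * Real.exp (θ * netDeath lam a t)) ^ (-(1 / θ)) := by
        refine Real.rpow_le_rpow_of_nonpos (mul_pos hκ hexp) ?_ (by simpa using hθ.le)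
        exact le_add_of_nonneg_right (by positivity)
    _ = (1 - s) * Real.exp (-netDeath lam a t) := by
        rw [Real.mul_rpow hκ.le hexp.le, ← Real.rpow_mul h1s.le, hmul, Real.rpow_one,
          ← Real.exp_mul, hmul']

theorem survivalMean_le_ofReal (hZ : IsThetaPositiveBranchingProcess P θ lam a Z)
    (ha : IntegrableOn (fun u => a u * lam u) (Set.Ioi 0)) (t : ℝ≥0) :
    survivalMean P Z t ≤ ENNReal.ofReal ((1 + θ / (1 + θ) *
      (weightedBirth θ lam a t * Real.exp (-θ * netDeath lam a t))) ^ (1 / θ)) := by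
  obtain ⟨p, hp, -⟩ := hZ.branching
  have hθ := hZ.theta_pos
  have hJ := weightedBirth_nonneg (θ := θ) hp.rate_nonneg hZ.mean_nonneg t.coe_nonneg
  set D := netDeath lam a t
  set J := weightedBirth θ lam a t
  have hH : 0 < Real.exp (θ * D) + θ / (1 + θ) * J :=
    add_pos_of_pos_of_nonneg (Real.exp_pos _) (by positivity)
  have hexp : Real.exp (-θ * D) * Real.exp (θ * D) = 1 := by
    rw [← Real.exp_add]
    simp
  have hmul : -θ * D * (1 / θ) = -D := by field_simp
  have heq : ((Real.exp (θ * D) + θ / (1 + θ) * J) ^ (-(1 / θ)))⁻¹ * Real.exp (-D) =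
      (1 + θ / (1 + θ) * (J * Real.exp (-θ * D))) ^ (1 / θ) := by
    rw [Real.rpow_neg hH.le, inv_inv, ← hmul, Real.exp_mul (-θ * D),
      ← Real.mul_rpow hH.le (Real.exp_pos _).le]
    congr 1
    linear_combination hexp
  rw [← heq, ENNReal.ofReal_mul (by positivity),
    ENNReal.ofReal_inv_of_pos (Real.rpow_pos_of_pos hH _), ← hZ.measure_survival ha t]
  refine survivalMean_le.trans ?_
  gcongr
  exact hZ.lintegral_le ha t

end IsThetaPositiveBranchingProcess

theorem mainTheorem9 {Ω : Type*} [MeasurableSpace Ω] (P : Measure Ω) [IsProbabilityMeasure P]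
    (θ : ℝ) (lam a : ℝ → ℝ) (Z : ℝ≥0 → Ω → ℕ)
    (hZ : IsThetaPositiveBranchingProcess P θ lam a Z)
    (hLam : Tendsto (cumulativeHazard lam) atTop atTop)
    (ha : IntegrableOn (fun u => a u * lam u) (Set.Ioi 0)) :
    IsStrictlySubcritical P Z := by
  obtain ⟨p, hp, -⟩ := hZ.branching
  have hθ := hZ.theta_pos
  have hcoe : Tendsto (fun t : ℝ≥0 => (t : ℝ)) atTop atTop := NNReal.tendsto_coe_atTop.2 tendsto_id
  have hJ : ∀ t : ℝ≥0, 0 ≤ weightedBirth θ lam a t := fun t =>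
    weightedBirth_nonneg hp.rate_nonneg hZ.mean_nonneg t.coe_nonneg
  have hD : Tendsto (fun t : ℝ≥0 => netDeath lam a t) atTop atTop :=
    (tendsto_netDeath hp.rate_integrable ha hp.rate_nonneg hZ.mean_nonneg hLam).comp hcoe
  have hH : Tendsto (fun t : ℝ≥0 => Real.exp (θ * netDeath lam a t) +
      θ / (1 + θ) * weightedBirth θ lam a t) atTop atTop := by
    refine tendsto_atTop_mono (fun t => ?_) (Real.tendsto_exp_atTop.comp (hD.const_mul_atTop hθ))
    have := hJ t
    exact le_add_of_nonneg_right (by positivity)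
  -- The limiting conditional mean is `1`: a surviving population has size at least one, and the
  -- upper bound tends to `1`.
  refine ⟨?_, 1, le_rfl, ?_⟩
  · have h1 := (tendsto_rpow_neg_atTop (one_div_pos.2 hθ)).comp hH
    have h2 := ENNReal.tendsto_ofReal (h1.const_sub 1)
    rw [sub_zero, ENNReal.ofReal_one] at h2
    refine h2.congr fun t => ?_
    rw [← ofReal_measureReal (μ := P) (s := {ω | Z t ω = 0}), hZ.measureReal_extinct ha t]
    rfl
  · have h1 := (tendsto_weightedBirth_mul_exp hθ hp.rate_integrable ha hp.rate_nonneg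
      hZ.mean_nonneg hLam).comp hcoe
    have h2 := ENNReal.tendsto_ofReal (((h1.const_mul (θ / (1 + θ))).const_add 1).rpow_const
      (p := 1 / θ) (Or.inl (by simp)))
    rw [mul_zero, add_zero, Real.one_rpow, ENNReal.ofReal_one] at h2
    rw [ENNReal.coe_one]
    refine tendsto_of_tendsto_of_tendsto_of_le_of_le tendsto_const_nhds h2 (fun t => ?_)
      fun t => hZ.survivalMean_le_ofReal ha t
    refine one_le_survivalMean (hp.measurable t) ?_
    rw [hZ.measure_survival ha t]
    have := hJ t
    simpa using Real.rpow_pos_of_pos (add_pos_of_pos_of_nonneg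
      (Real.exp_pos (θ * netDeath lam a t)) (by positivity)) _
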